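/- Let $\mathfrak n$ be a nonzero finite-dimensional nilpotent Lie algebra over $\mathbb Q$ with a positive grading, i.e. a decomposition into subspaces $\mathfrak n=\bigoplus_{i\in\mathbb Z}\mathfrak n_i$ with $[\mathfrak n_i,\mathfrak n_j]\subseteq\mathfrak n_{i+j}$ for all $i,j$ and $\mathfrak n_i=0$ for $i\le 0$. Let $N^{\mathbb Q}=\exp(\mathfrak n)$ be the corresponding nilpotent group, whose elements are $\exp(x)$ for $x\in\mathfrak n$ ($\exp$ being a bijection with inverse $\log$) and whose multiplication is given by the Baker–Campbell–Hausdorff formula; identify $\operatorname{Aut}(N^{\mathbb Q})$ with $\operatorname{Aut}(\mathfrak n)$ through $\exp$. A full subgroup of $N^{\mathbb Q}$ is a finitely generated subgroup $N$ such that $\log(N)$ spans $\mathfrak n$ over $\mathbb Q$. Then there exist a full subgroup $N$ of $N^{\mathbb Q}$ and an integer $k>0$ such that for every prime $p$ there is an injective group morphism $\varphi_p\colon N\to N$ with the following properties. Denote by $\varphi_p\in\operatorname{Aut}(\mathfrak n)$ also the unique automorphism of $\mathfrak n$ that extends it, i.e. with $\varphi_p(\exp x)=\exp(\varphi_p(x))$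 whenever $\exp x\in N$. Then - $\det(\varphi_p)=p^k$; - $\varphi_p$ is expanding, i.e. every complex eigenvalue of $\varphi_p$ has absolute value $>1$; - $\varphi_p\circ\psi=\psi\circ\varphi_p$ for every automorphism $\psi\in\operatorname{Aut}(\mathfrak n)$ that preserves the grading, i.e. with $\psi(\mathfrak n_i)=\mathfrak n_i$ for all $i\in\mathbb Z$. -/

import Mathlib

namespace RationalMalcev

/-- Right-nested Lie bracket of a word: `[a₁, a₂, …, aₘ] ↦ ⁅a₁, ⁅a₂, ⁅…, aₘ⁆⁆⁆`
(a word with one letter is mapped to that letter). -/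
def nestedBracket {L : Type*} [LieRing L] : List L → L
  | [] => 0
  | [a] => a
  | a :: b :: l => ⁅a, nestedBracket (b :: l)⁆

/-- The word `x^{r₁} y^{s₁} x^{r₂} y^{s₂} ⋯ x^{rₙ} y^{sₙ}`, where `f i = (rᵢ, sᵢ)`. -/
def dynkinWord {L : Type*} (x y : L) {n : ℕ} (f : Fin n → ℕ × ℕ) : List L :=
  (List.ofFn fun i => List.replicate (f i).1 x ++ List.replicate (f i).2 y).flatten

/-- The Baker–Campbell–Hausdorff series `log (exp x * exp y)` in Dynkin's form,
`∑_{n ≥ 1} (-1)^(n-1) / n ∑_{rᵢ + sᵢ > 0}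
  [x^{r₁} y^{s₁} ⋯ x^{rₙ} y^{sₙ}] / ((∑ᵢ (rᵢ + sᵢ)) ∏ᵢ rᵢ! sᵢ!)`.
In a Lie algebra of nilpotency class `c` all brackets of more than `c` letters vanish. Terms
with `n > c`, some `rᵢ > c` or some `sᵢ > c` have more than `c` letters, so that the
finite sum below is the whole series. -/
noncomputable def bch {L : Type*} [LieRing L] [LieAlgebra ℚ L] (x y : L) : L :=
  ∑ n ∈ Finset.Icc 1 (LieModule.nilpotencyLength L L),
    ∑ f ∈ Fintype.piFinset fun _ : Fin n =>
        (Finset.range (LieModule.nilpotencyLength L L + 1) ×ˢ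
          Finset.range (LieModule.nilpotencyLength L L + 1)).filter fun rs => 0 < rs.1 + rs.2,
      ((-1 : ℚ) ^ (n - 1) / (n : ℚ) *
          (((∑ i, ((f i).1 + (f i).2) : ℕ) : ℚ) *
            ((∏ i, ((f i).1.factorial * (f i).2.factorial) : ℕ) : ℚ))⁻¹) •
        nestedBracket (dynkinWord x y f)

/-- The nilpotent (radicable, torsion-free) group `N^ℚ = exp(𝔫)` of a rational nilpotent Lie
algebra `𝔫 = L`: its elements are the `exp x` with `x ∈ L`, so that `exp : L → N^ℚ` is a bijection
with inverse `log`, and they are multiplied by the Baker–Campbell–Hausdorff formula. -/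
@[ext]
structure MalcevGroup (L : Type*) where
  /-- the exponential map `L → N^ℚ` -/
  exp ::
  /-- the logarithm `N^ℚ → L` -/
  log : L

namespace MalcevGroup

noncomputable instance {L : Type*} [LieRing L] [LieAlgebra ℚ L] : Mul (MalcevGroup L) :=
  ⟨fun g h => exp (bch g.log h.log)⟩

instance {L : Type*} [LieRing L] : One (MalcevGroup L) := ⟨exp 0⟩

instance {L : Type*} [LieRing L] : Inv (MalcevGroup L) := ⟨fun g => exp (-g.log)⟩

/-- The map `exp x ↦ exp (Φ x)` of `N^ℚ` given by an automorphism `Φ` of the Lie algebra; this is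
the identification of `Aut(𝔫)` with `Aut(N^ℚ)`. -/
def map {L : Type*} [LieRing L] [LieAlgebra ℚ L] (Φ : L ≃ₗ⁅ℚ⁆ L) (g : MalcevGroup L) :
    MalcevGroup L :=
  exp (Φ g.log)

end MalcevGroup

/-- A subgroup of `N^ℚ`. -/
structure MalcevSubgroup (L : Type*) [LieRing L] [LieAlgebra ℚ L] where
  carrier : Set (MalcevGroup L)
  one_mem : 1 ∈ carrier
  mul_mem : ∀ {g h : MalcevGroup L}, g ∈ carrier → h ∈ carrier → g * h ∈ carrier
  inv_mem : ∀ {g : MalcevGroup L}, g ∈ carrier → g⁻¹ ∈ carrier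

noncomputable instance {L : Type*} [LieRing L] [LieAlgebra ℚ L] (N : MalcevSubgroup L) :
    Mul N.carrier :=
  ⟨fun g h => ⟨g.1 * h.1, N.mul_mem g.2 h.2⟩⟩

/-- `N` is generated by finitely many elements: it contains a finite set `S` and lies in every
subgroup that contains `S`. -/
def MalcevSubgroup.FG {L : Type*} [LieRing L] [LieAlgebra ℚ L] (N : MalcevSubgroup L) : Prop :=
  ∃ S : Finset (MalcevGroup L), (S : Set (MalcevGroup L)) ⊆ N.carrier ∧
    ∀ H : MalcevSubgroup L, (S : Set (MalcevGroup L)) ⊆ H.carrier → N.carrier ⊆ H.carrier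

/-- A full subgroup of `N^ℚ`: a finitely generated subgroup `N` such that `log(N)` spans the
rational Lie algebra as a vector space. -/
def MalcevSubgroup.IsFull {L : Type*} [LieRing L] [LieAlgebra ℚ L] (N : MalcevSubgroup L) : Prop :=
  N.FG ∧ Submodule.span ℚ (MalcevGroup.log '' N.carrier) = ⊤

/-- The automorphism `Φ` of the Lie algebra, seen as an automorphism of `N^ℚ`, extends the
endomorphism `φ` of the subgroup `N`. -/
def IsExtension {L : Type*} [LieRing L] [LieAlgebra ℚ L] {N : MalcevSubgroup L}
    (φ : N.carrier →ₙ* N.carrier) (Φ : L ≃ₗ⁅ℚ⁆ L) : Prop :=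
  ∀ g : N.carrier, (φ g : MalcevGroup L) = MalcevGroup.map Φ g

/-- An endomorphism of a full subgroup has at most one extension, so that its determinant and its
eigenvalues, which are those of the extension, are well defined. -/
theorem IsExtension.unique {L : Type*} [LieRing L] [LieAlgebra ℚ L] {N : MalcevSubgroup L}
    (hN : N.IsFull) {φ : N.carrier →ₙ* N.carrier} {Φ Ψ : L ≃ₗ⁅ℚ⁆ L}
    (hΦ : IsExtension φ Φ) (hΨ : IsExtension φ Ψ) : Φ = Ψ := by
  have h : (Φ : L →ₗ[ℚ] L) = (Ψ : L →ₗ[ℚ] L) := by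
    refine LinearMap.ext_on hN.2 ?_
    rintro _ ⟨g, hg, rfl⟩
    have h1 := (hΦ ⟨g, hg⟩).symm.trans (hΨ ⟨g, hg⟩)
    exact congrArg MalcevGroup.log h1
  ext x
  exact LinearMap.congr_fun h x

theorem map_nestedBracket {L : Type*} [LieRing L] [LieAlgebra ℚ L] (Φ : L ≃ₗ⁅ℚ⁆ L) :
    ∀ l : List L, Φ (nestedBracket l) = nestedBracket (l.map Φ)
  | [] => by simp [nestedBracket]
  | [a] => by simp [nestedBracket]
  | a :: b :: l => by
    have h := map_nestedBracket Φ (b :: l)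
    simp only [List.map_cons] at h
    rw [List.map_cons, List.map_cons, nestedBracket, nestedBracket, LieEquiv.map_lie, h]

/-- An automorphism of the Lie algebra is multiplicative on `N^ℚ`. -/
theorem MalcevGroup.map_mul {L : Type*} [LieRing L] [LieAlgebra ℚ L] (Φ : L ≃ₗ⁅ℚ⁆ L)
    (g h : MalcevGroup L) : map Φ (g * h) = map Φ g * map Φ h := by
  change exp (Φ (bch g.log h.log)) = exp (bch (Φ g.log) (Φ h.log))
  congr 1
  have hw : ∀ (n : ℕ) (f : Fin n → ℕ × ℕ),
      (dynkinWord g.log h.log f).map Φ = dynkinWord (Φ g.log) (Φ h.log) f := by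
    intro n f
    simp [dynkinWord, List.map_flatten, List.map_ofFn, Function.comp_def]
  simp only [bch, map_sum, map_smul, map_nestedBracket, hw]

/-- A positive grading `𝔫 = ⨁_{i ∈ ℤ} 𝔫ᵢ` of a rational Lie algebra. -/
structure IsPositiveGrading {L : Type*} [LieRing L] [LieAlgebra ℚ L] (𝒜 : ℤ → Submodule ℚ L) :
    Prop where
  isInternal : DirectSum.IsInternal 𝒜
  lie_mem : ∀ {i j : ℤ} {x y : L}, x ∈ 𝒜 i → y ∈ 𝒜 j → ⁅x, y⁆ ∈ 𝒜 (i + j)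
  eq_bot : ∀ i : ℤ, i ≤ 0 → 𝒜 i = ⊥

/-- `ψ(𝔫ᵢ) = 𝔫ᵢ` for all `i`. -/
def PreservesGrading {L : Type*} [LieRing L] [LieAlgebra ℚ L] (𝒜 : ℤ → Submodule ℚ L)
    (ψ : L ≃ₗ⁅ℚ⁆ L) : Prop :=
  ∀ i : ℤ, (𝒜 i).map (ψ : L →ₗ[ℚ] L) = 𝒜 i

/-- All complex eigenvalues of `Φ` have absolute value `> 1`. -/
def IsExpanding {L : Type*} [LieRing L] [LieAlgebra ℚ L] [FiniteDimensional ℚ L]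
    (Φ : L ≃ₗ⁅ℚ⁆ L) : Prop :=
  ∀ z : ℂ, ((Φ : L →ₗ[ℚ] L).charpoly.map (algebraMap ℚ ℂ)).IsRoot z → 1 < ‖z‖

end RationalMalcev

/-! Multiplying degree `i` by `p ^ i` is a Lie automorphism. It is scalar on each graded piece, so
it commutes with everything preserving the grading. In a homogeneous basis `b j` of degrees `d j >
0` it is diagonal with entries `p ^ d j`, hence expanding, of determinant `p ^ ∑ d j`. One subgroup
serves all primes: let `N` be generated by the `exp (b j)`. The automorphism sends a generator to
`exp (p ^ d j • b j)`, which is its `p ^ d j`-th power, since the Baker–Campbell–Hausdorff product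
is addition on a line (`bch_eq_add`). So `N` is mapped into itself. -/

namespace RationalMalcev

/-! ### Scaling automorphisms of a positive grading -/

section Scaling

variable {L : Type*} [LieRing L] [LieAlgebra ℚ L] {𝒜 : ℤ → Submodule ℚ L}

/-- The linear map that multiplies the elements of degree `i` by `c ^ i`. -/
noncomputable def IsPositiveGrading.scale (h : IsPositiveGrading 𝒜) (c : ℚ) : L →ₗ[ℚ] L :=
  (DirectSum.toModule ℚ ℤ L fun i => c ^ i • (𝒜 i).subtype) ∘ₗ
    (LinearEquiv.ofBijective (DirectSum.coeLinearMap 𝒜) h.isInternal).symm.toLinearMap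

theorem IsPositiveGrading.scale_apply (h : IsPositiveGrading 𝒜) (c : ℚ) {i : ℤ} {x : L}
    (hx : x ∈ 𝒜 i) : h.scale c x = c ^ i • x := by
  have he : (LinearEquiv.ofBijective (DirectSum.coeLinearMap 𝒜) h.isInternal).symm x =
      DirectSum.lof ℚ ℤ (fun i => 𝒜 i) i ⟨x, hx⟩ := by
    rw [LinearEquiv.symm_apply_eq]
    exact (DirectSum.coeLinearMap_lof 𝒜 i ⟨x, hx⟩).symm
  simp [IsPositiveGrading.scale, he]

/-- A property closed under addition holds everywhere if it holds for homogeneous elements. -/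
theorem IsPositiveGrading.induction_on (h : IsPositiveGrading 𝒜) {P : L → Prop} (x : L)
    (hom : ∀ i, ∀ x ∈ 𝒜 i, P x) (add : ∀ x y, P x → P y → P (x + y)) : P x :=
  Submodule.iSup_induction 𝒜 (motive := P)
    (by rw [h.isInternal.submodule_iSup_eq_top]; exact Submodule.mem_top) hom
    -- Zero is homogeneous, so it needs no case of its own.
    (hom 0 0 (Submodule.zero_mem _)) add

/-- For `c ≠ 0`, scaling by `c ^ i` in degree `i` is an automorphism of the graded Lie algebra. -/
noncomputable def IsPositiveGrading.scaleEquiv (h : IsPositiveGrading 𝒜) {c : ℚ} (hc : c ≠ 0) :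
    L ≃ₗ⁅ℚ⁆ L :=
  { h.scale c with
    map_lie' := by
      intro x y
      change h.scale c ⁅x, y⁆ = ⁅h.scale c x, h.scale c y⁆
      induction x using h.induction_on with
      | add x x' hx hx' => simp only [add_lie, map_add, hx, hx']
      | hom i x hx =>
        induction y using h.induction_on with
        | add y y' hy hy' => simp only [lie_add, map_add, hy, hy']
        | hom j y hy =>
          rw [h.scale_apply c hx, h.scale_apply c hy, h.scale_apply c (h.lie_mem hx hy),
            smul_lie, lie_smul, smul_smul, zpow_add₀ hc]
    invFun := h.scale c⁻¹
    left_inv := by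
      intro x
      change h.scale c⁻¹ (h.scale c x) = x
      induction x using h.induction_on with
      | add x y hx hy => simp only [map_add, hx, hy]
      | hom i x hx =>
        rw [h.scale_apply c hx, map_smul, h.scale_apply _ hx, smul_smul, inv_zpow,
          mul_inv_cancel₀ (zpow_ne_zero i hc), one_smul]
    right_inv := by
      intro x
      change h.scale c (h.scale c⁻¹ x) = x
      induction x using h.induction_on with
      | add x y hx hy => simp only [map_add, hx, hy]
      | hom i x hx =>
        rw [h.scale_apply _ hx, map_smul, h.scale_apply c hx, smul_smul, inv_zpow,
          inv_mul_cancel₀ (zpow_ne_zero i hc), one_smul] }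

theorem IsPositiveGrading.scaleEquiv_apply (h : IsPositiveGrading 𝒜) {c : ℚ} (hc : c ≠ 0)
    {i : ℤ} {x : L} (hx : x ∈ 𝒜 i) : h.scaleEquiv hc x = c ^ i • x :=
  h.scale_apply c hx

theorem IsPositiveGrading.scaleEquiv_comm (h : IsPositiveGrading 𝒜) {c : ℚ} (hc : c ≠ 0)
    {ψ : L ≃ₗ⁅ℚ⁆ L} (hψ : PreservesGrading 𝒜 ψ) (x : L) :
    h.scaleEquiv hc (ψ x) = ψ (h.scaleEquiv hc x) := by
  induction x using h.induction_on with
  | add x y hx hy => simp only [map_add, hx, hy]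
  | hom i x hx =>
    have hψx : ψ x ∈ 𝒜 i := by
      rw [← hψ i]
      exact Submodule.mem_map_of_mem hx
    rw [h.scaleEquiv_apply hc hx, h.scaleEquiv_apply hc hψx, map_smul]

theorem IsPositiveGrading.pos_of_mem (h : IsPositiveGrading 𝒜) {i : ℤ} {x : L} (hx : x ∈ 𝒜 i)
    (hx0 : x ≠ 0) : 0 < i := by
  by_contra hi
  rw [h.eq_bot i (not_lt.mp hi)] at hx
  exact hx0 ((Submodule.mem_bot ℚ).mp hx)

/-- A finite-dimensional positively graded Lie algebra has a finite basis of homogeneous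
elements of positive degree. -/
theorem IsPositiveGrading.exists_basis [FiniteDimensional ℚ L] (h : IsPositiveGrading 𝒜) :
    ∃ (n : ℕ) (b : Module.Basis (Fin n) ℚ L) (d : Fin n → ℕ),
      ∀ j, 0 < d j ∧ b j ∈ 𝒜 (d j) := by
  let b := h.isInternal.collectedBasis fun i => Module.finBasis ℚ (𝒜 i)
  have := Module.Finite.finite_basis b
  obtain ⟨n, ⟨e⟩⟩ := Finite.exists_equiv_fin (Σ i : ℤ, Fin (Module.finrank ℚ (𝒜 i)))
  -- Degrees of nonzero elements are positive, so `toNat` loses nothing.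
  refine ⟨n, b.reindex e, fun j => (e.symm j).1.toNat, fun j => ?_⟩
  have hm : b (e.symm j) ∈ 𝒜 (e.symm j).1 := h.isInternal.collectedBasis_mem _ _
  have hp := h.pos_of_mem hm (b.ne_zero _)
  rw [Module.Basis.reindex_apply, Int.toNat_of_nonneg hp.le]
  exact ⟨Int.pos_iff_toNat_pos.mp hp, hm⟩

end Scaling

/-! ### Maps diagonal in a basis -/

section Diagonal

variable {K V ι : Type*} [Field K] [AddCommGroup V] [Module K V] [Fintype ι] [DecidableEq ι]

theorem toMatrix_eq_diagonal_of_apply_basis (b : Module.Basis ι K V) (f : V →ₗ[K] V) (a : ι → K)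
    (hf : ∀ j, f (b j) = a j • b j) : LinearMap.toMatrix b b f = Matrix.diagonal a := by
  ext i j
  rw [LinearMap.toMatrix_apply, hf, map_smul, Module.Basis.repr_self, Finsupp.smul_apply,
    Finsupp.single_apply, Matrix.diagonal_apply]
  by_cases hij : i = j
  · subst hij; simp
  · simp [hij, Ne.symm hij]

end Diagonal

/-! ### Powers in the Malcev group -/

section Powers

theorem length_dynkinWord {L : Type*} (x y : L) {n : ℕ} (f : Fin n → ℕ × ℕ) :
    (dynkinWord x y f).length = ∑ i, ((f i).1 + (f i).2) := by
  simp [dynkinWord, List.length_flatten, List.map_ofFn, Function.comp_def, List.sum_ofFn]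

theorem mem_dynkinWord {L : Type*} {x y a : L} {n : ℕ} {f : Fin n → ℕ × ℕ} (h : a ∈ dynkinWord x y f) :
    a = x ∨ a = y := by
  simp only [dynkinWord, List.mem_flatten, List.mem_ofFn] at h
  obtain ⟨l, ⟨i, rfl⟩, ha⟩ := h
  rcases List.mem_append.mp ha with ha | ha
  · exact Or.inl (List.eq_of_mem_replicate ha)
  · exact Or.inr (List.eq_of_mem_replicate ha)

variable {L : Type*} [LieRing L] [LieAlgebra ℚ L]

/-- Two multiples of `e` commute. Membership in the line is carried along so that the inner bracket
is again such a multiple. -/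
theorem nestedBracket_mem_span (e : L) :
    ∀ l : List L, (∀ a ∈ l, a ∈ Submodule.span ℚ {e}) →
      nestedBracket l ∈ Submodule.span ℚ {e} ∧ (2 ≤ l.length → nestedBracket l = 0)
  | [], _ => by simp [nestedBracket]
  | [a], h => by simpa [nestedBracket] using h
  | a :: b :: l, h => by
    have ih := (nestedBracket_mem_span e (b :: l) fun c hc => h c (List.mem_cons_of_mem _ hc)).1
    obtain ⟨r, hr⟩ := Submodule.mem_span_singleton.mp ih
    obtain ⟨s, hs⟩ := Submodule.mem_span_singleton.mp (h a List.mem_cons_self)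
    have h0 : nestedBracket (a :: b :: l) = 0 := by
      rw [nestedBracket, ← hr, ← hs, smul_lie, lie_smul, lie_self, smul_zero, smul_zero]
    exact ⟨h0 ▸ Submodule.zero_mem _, fun _ => h0⟩

theorem nestedBracket_dynkinWord_eq_zero {e x y : L} (hx : x ∈ Submodule.span ℚ {e})
    (hy : y ∈ Submodule.span ℚ {e}) {n : ℕ} (f : Fin n → ℕ × ℕ)
    (hf : 2 ≤ ∑ i, ((f i).1 + (f i).2)) : nestedBracket (dynkinWord x y f) = 0 := by
  refine (nestedBracket_mem_span e _ fun a ha => ?_).2 (by rwa [length_dynkinWord])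
  rcases mem_dynkinWord ha with rfl | rfl <;> assumption

/-- On a line the Baker–Campbell–Hausdorff product is the addition. -/
theorem bch_eq_add [LieRing.IsNilpotent L] [Nontrivial L] {e x y : L}
    (hx : x ∈ Submodule.span ℚ {e}) (hy : y ∈ Submodule.span ℚ {e}) : bch x y = x + y := by
  -- The truncated series must reach `n = 1`, the only term that survives.
  have hc : 0 < LieModule.nilpotencyLength L L := by
    rw [Nat.pos_iff_ne_zero]
    intro h
    rw [LieModule.nilpotencyLength_eq_zero_iff] at h
    exact not_subsingleton L h
  rw [bch, Finset.sum_eq_single_of_mem 1 (Finset.mem_Icc.mpr ⟨le_rfl, hc⟩)]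
  · have hne : (fun _ : Fin 1 => ((1, 0) : ℕ × ℕ)) ≠ fun _ => (0, 1) := fun h => by
      simpa using congrFun h 0
    -- For `n = 1` only the one-letter words `x` and `y` contribute.
    rw [← Finset.sum_subset (s₁ := {fun _ => (1, 0), fun _ => (0, 1)})]
    · rw [Finset.sum_pair hne]
      simp [dynkinWord, nestedBracket]
    · intro f hf
      simp only [Finset.mem_insert, Finset.mem_singleton] at hf
      rcases hf with rfl | rfl <;> simp [Fintype.mem_piFinset] <;> omega
    · intro f hf hf'
      rw [nestedBracket_dynkinWord_eq_zero hx hy f, smul_zero]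
      have h0 := (Finset.mem_filter.mp (Fintype.mem_piFinset.mp hf 0)).2
      rw [Fin.sum_univ_one]
      by_contra hlt
      apply hf'
      have h1 : f 0 = (1, 0) ∨ f 0 = (0, 1) := by
        simp only [Prod.ext_iff]
        omega
      simp only [Finset.mem_insert, Finset.mem_singleton, funext_iff, Fin.forall_fin_one]
      exact h1
  · intro n hn hn1
    refine Finset.sum_eq_zero fun f hf => ?_
    rw [nestedBracket_dynkinWord_eq_zero hx hy f, smul_zero]
    -- Each pair supplies a letter, so `n ≥ 2` gives at least two letters.
    have h1 : ∑ _i : Fin n, 1 ≤ ∑ i, ((f i).1 + (f i).2) :=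
      Finset.sum_le_sum fun i _ => (Finset.mem_filter.mp (Fintype.mem_piFinset.mp hf i)).2
    simp only [Finset.sum_const, Finset.card_univ, Fintype.card_fin, smul_eq_mul, mul_one] at h1
    have := (Finset.mem_Icc.mp hn).1
    omega

theorem MalcevSubgroup.exp_nsmul_mem [LieRing.IsNilpotent L] [Nontrivial L] (N : MalcevSubgroup L)
    {e : L} (he : MalcevGroup.exp e ∈ N.carrier) (m : ℕ) :
    MalcevGroup.exp (m • e) ∈ N.carrier := by
  induction m with
  | zero => rw [zero_smul]; exact N.one_mem
  | succ m ih =>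
    have hs : e ∈ Submodule.span ℚ {e} := Submodule.mem_span_singleton_self e
    rw [succ_nsmul, ← bch_eq_add (nsmul_mem hs m) hs]
    exact N.mul_mem ih he

end Powers

/-! ### Generated subgroups and restriction of automorphisms -/

section Closure

variable {L : Type*} [LieRing L] [LieAlgebra ℚ L]

/-- The subgroup of `N^ℚ` generated by a set. -/
def MalcevSubgroup.closure (S : Set (MalcevGroup L)) : MalcevSubgroup L where
  carrier := {g | ∀ H : MalcevSubgroup L, S ⊆ H.carrier → g ∈ H.carrier}
  one_mem H _ := H.one_mem
  mul_mem hg hh H hS := H.mul_mem (hg H hS) (hh H hS)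
  inv_mem hg H hS := H.inv_mem (hg H hS)

theorem MalcevSubgroup.subset_closure (S : Set (MalcevGroup L)) : S ⊆ (closure S).carrier :=
  fun _ hg _ hS => hS hg

/-- The preimage of a subgroup under an automorphism. -/
def MalcevSubgroup.comap (Φ : L ≃ₗ⁅ℚ⁆ L) (N : MalcevSubgroup L) : MalcevSubgroup L where
  carrier := {g | MalcevGroup.map Φ g ∈ N.carrier}
  one_mem := by
    change MalcevGroup.exp (Φ 0) ∈ N.carrier
    rw [map_zero]
    exact N.one_mem
  mul_mem {g h} hg hh := by
    change MalcevGroup.map Φ (g * h) ∈ N.carrier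
    rw [MalcevGroup.map_mul]
    exact N.mul_mem hg hh
  inv_mem {g} hg := by
    change MalcevGroup.exp (Φ (-g.log)) ∈ N.carrier
    rw [map_neg]
    exact N.inv_mem hg

/-- The preimage of the closure is a subgroup containing `S`, hence contains the closure. -/
theorem MalcevSubgroup.map_mem_closure {S : Set (MalcevGroup L)} (Φ : L ≃ₗ⁅ℚ⁆ L)
    (h : ∀ g ∈ S, MalcevGroup.map Φ g ∈ (closure S).carrier) {g : MalcevGroup L}
    (hg : g ∈ (closure S).carrier) : MalcevGroup.map Φ g ∈ (closure S).carrier :=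
  hg (comap Φ (closure S)) h

/-- The restriction of an automorphism of `N^ℚ` to a subgroup that it maps into itself. -/
def MalcevSubgroup.restrict (N : MalcevSubgroup L) (Φ : L ≃ₗ⁅ℚ⁆ L)
    (h : ∀ g ∈ N.carrier, MalcevGroup.map Φ g ∈ N.carrier) : N.carrier →ₙ* N.carrier where
  toFun g := ⟨MalcevGroup.map Φ g, h g g.2⟩
  map_mul' g g' := Subtype.ext (MalcevGroup.map_mul Φ g g')

theorem MalcevSubgroup.restrict_injective (N : MalcevSubgroup L) (Φ : L ≃ₗ⁅ℚ⁆ L)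
    (h : ∀ g ∈ N.carrier, MalcevGroup.map Φ g ∈ N.carrier) :
    Function.Injective (N.restrict Φ h) := fun _ _ hg =>
  Subtype.ext (MalcevGroup.ext (Φ.injective
    (congrArg (fun x : N.carrier => x.1.log) hg)))

end Closure

end RationalMalcev

open RationalMalcev

theorem corollary3p3 {L : Type*} [LieRing L] [LieAlgebra ℚ L] [FiniteDimensional ℚ L]
    [LieRing.IsNilpotent L] [Nontrivial L]
    (𝒜 : ℤ → Submodule ℚ L) (h𝒜 : RationalMalcev.IsPositiveGrading 𝒜) :
    ∃ N : RationalMalcev.MalcevSubgroup L, N.IsFull ∧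
      ∃ k : ℕ, 0 < k ∧ ∀ p : ℕ, p.Prime →
        ∃ φ : N.carrier →ₙ* N.carrier, Function.Injective φ ∧
          ∃ Φ : L ≃ₗ⁅ℚ⁆ L, RationalMalcev.IsExtension φ Φ ∧
            LinearMap.det (Φ : L →ₗ[ℚ] L) = (p : ℚ) ^ k ∧
            RationalMalcev.IsExpanding Φ ∧
            ∀ ψ : L ≃ₗ⁅ℚ⁆ L, RationalMalcev.PreservesGrading 𝒜 ψ →
              ∀ x : L, Φ (ψ x) = ψ (Φ x) := by
  classical
  obtain ⟨n, b, d, hd⟩ := h𝒜.exists_basis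
  let S : Finset (MalcevGroup L) := Finset.univ.image fun j => MalcevGroup.exp (b j)
  let N : MalcevSubgroup L := MalcevSubgroup.closure (S : Set (MalcevGroup L))
  have hbN (j : Fin n) : MalcevGroup.exp (b j) ∈ N.carrier :=
    MalcevSubgroup.subset_closure _
      (Finset.mem_coe.mpr (Finset.mem_image_of_mem _ (Finset.mem_univ j)))
  refine ⟨N, ⟨⟨S, MalcevSubgroup.subset_closure _, fun H hH g hg => hg H hH⟩, ?_⟩, ∑ j, d j, ?_,
    fun p hp => ?_⟩
  · rw [eq_top_iff, ← b.span_eq]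
    refine Submodule.span_mono ?_
    rintro _ ⟨j, rfl⟩
    exact ⟨_, hbN j, rfl⟩
  · have : Nonempty (Fin n) := b.index_nonempty
    exact Finset.sum_pos (fun j _ => (hd j).1) Finset.univ_nonempty
  · have hp0 : (p : ℚ) ≠ 0 := Nat.cast_ne_zero.mpr hp.ne_zero
    let Φ := h𝒜.scaleEquiv hp0
    have hΦ (j : Fin n) : Φ (b j) = (p : ℚ) ^ d j • b j := by
      rw [h𝒜.scaleEquiv_apply hp0 (hd j).2, zpow_natCast]
    have hN : ∀ g ∈ N.carrier, MalcevGroup.map Φ g ∈ N.carrier := by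
      refine fun g hg => MalcevSubgroup.map_mem_closure Φ (fun g hg => ?_) hg
      obtain ⟨j, -, rfl⟩ := Finset.mem_image.mp (Finset.mem_coe.mp hg)
      -- Integrality enters here: `p ^ d j` is a natural number, so the image of a generator is a
      -- genuine power of it.
      have h := N.exp_nsmul_mem (hbN j) (p ^ d j)
      rw [← Nat.cast_smul_eq_nsmul ℚ, Nat.cast_pow, ← hΦ] at h
      exact h
    have hM := toMatrix_eq_diagonal_of_apply_basis b (Φ : L →ₗ[ℚ] L) _ hΦ
    refine ⟨N.restrict Φ hN, N.restrict_injective Φ hN, Φ, fun g => rfl, ?_, fun z hz => ?_,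
      fun ψ hψ => h𝒜.scaleEquiv_comm hp0 hψ⟩
    · rw [← LinearMap.det_toMatrix b, hM, Matrix.det_diagonal, Finset.prod_pow_eq_pow_sum]
    · rw [← LinearMap.charpoly_toMatrix _ b, hM, Matrix.charpoly_diagonal, Polynomial.map_prod,
        Polynomial.IsRoot.def, Polynomial.eval_prod, Finset.prod_eq_zero_iff] at hz
      obtain ⟨j, -, hj⟩ := hz
      have hz : z = (p : ℂ) ^ d j := by simpa [sub_eq_zero] using hj
      rw [hz, norm_pow, Complex.norm_natCast]
      exact one_lt_pow₀ (by exact_mod_cast hp.one_lt) (hd j).1.ne'
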